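/- Let $M$ be a graphic matroid, that is, the cycle matroid $M(G)$ of a connected graph $G$ with finitely many edges (loops and parallel edges allowed): the ground set of $M(G)$ is $E(G)$ and its bases are the edge sets of spanning trees of $G$. Let $k \ge 1$ be an integer. Then $M$ is elementarily $(3k^3,k)$-weakly base orderable, meaning: for any two bases $B_1,B_2$ of $M$ with $|B_1\setminus B_2|\ge 3k^3$ there exist $k$-element subsets $X\subseteq B_1\setminus B_2$ and $Y\subseteq B_2\setminus B_1$ and a bijection $\varphi\colon X\to Y$ such that $(B_1\setminus Z)\cup\varphi(Z)$ is a basis of $M$ for every $Z\subseteq X$. -/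

import Mathlib

open scoped Graph

universe u v

namespace Graph

variable {α : Type u} {β : Type v}

/-- A (multi)graph is connected if it has a vertex and any two of its vertices are joined by a
walk. -/
def IsConnected (G : Graph α β) : Prop :=
  V(G).Nonempty ∧ ∀ x ∈ V(G), ∀ y ∈ V(G), Relation.ReflTransGen G.Adj x y

/-- A cycle of length `n + 1`: distinct vertices `v 0, …, v n` and distinct edges `e 0, …, e n`
such that `e i` joins `v i` and `v (i + 1)`, where the indices are taken modulo `n + 1`.
A loop is a cycle of length 1, and two parallel edges form a cycle of length 2. -/
structure IsCycle (G : Graph α β) {n : ℕ} (v : Fin (n + 1) → α) (e : Fin (n + 1) → β) : Prop where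
  vertex_injective : Function.Injective v
  edge_injective : Function.Injective e
  isLink : ∀ i, G.IsLink (e i) (v i) (v (i + 1))

/-- A graph is a tree if it is connected and contains no cycle. -/
def IsTree (G : Graph α β) : Prop :=
  G.IsConnected ∧ ∀ (n : ℕ) (v : Fin (n + 1) → α) (e : Fin (n + 1) → β), ¬ G.IsCycle v e

/-- `T` is the edge set of a spanning tree of `G`. (`G.restrict T` is the spanning subgraph of `G`
with vertex set `V(G)` and edge set `E(G) ∩ T`.) -/
def IsSpanningTree (G : Graph α β) (T : Set β) : Prop :=
  T ⊆ E(G) ∧ (G.restrict T).IsTree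

/-! ### Spanning trees satisfy the basis exchange axiom -/

theorem reach_symm {G : Graph α β} {x y : α} (h : Relation.ReflTransGen G.Adj x y) :
    Relation.ReflTransGen G.Adj y x := by
  induction h with
  | refl => exact .refl
  | tail _ h ih => exact .head h.symm ih

theorem reach_mono {G : Graph α β} {S T : Set β} (hST : S ⊆ T) {x y : α}
    (h : Relation.ReflTransGen (G.restrict S).Adj x y) :
    Relation.ReflTransGen (G.restrict T).Adj x y := by
  refine h.lift id ?_
  rintro a b ⟨e, he⟩
  simp only [restrict_isLink] at he
  exact ⟨e, by simp only [restrict_isLink]; grind⟩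

theorem reach_insert {G : Graph α β} {S : Set β} {f : β} {u w : α} (hf : G.IsLink f u w) {x y : α}
    (h : Relation.ReflTransGen (G.restrict (insert f S)).Adj x y) :
    Relation.ReflTransGen (G.restrict S).Adj x y ∨
    (Relation.ReflTransGen (G.restrict S).Adj x u ∧ Relation.ReflTransGen (G.restrict S).Adj w y) ∨
    (Relation.ReflTransGen (G.restrict S).Adj x w ∧
      Relation.ReflTransGen (G.restrict S).Adj u y) := by
  induction h with
  | refl => exact .inl .refl
  | @tail b c _ hbc ih =>
    obtain ⟨g, hg⟩ := hbc
    simp only [restrict_isLink] at hg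
    by_cases hgS : g ∈ S
    · have hbc : (G.restrict S).Adj b c := ⟨g, by simp only [restrict_isLink]; grind⟩
      rcases ih with h | ⟨h1, h2⟩ | ⟨h1, h2⟩
      · exact .inl (h.tail hbc)
      · exact .inr (.inl ⟨h1, h2.tail hbc⟩)
      · exact .inr (.inr ⟨h1, h2.tail hbc⟩)
    · have hgf : g = f := by grind
      subst hgf
      have hl : G.IsLink g b c := by grind
      rcases hf.eq_and_eq_or_eq_and_eq hl with ⟨rfl, rfl⟩ | ⟨rfl, rfl⟩
      · rcases ih with h | ⟨h1, h2⟩ | ⟨h1, h2⟩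
        · exact .inr (.inl ⟨h, .refl⟩)
        · exact .inr (.inl ⟨h1, .refl⟩)
        · exact .inl h1
      · rcases ih with h | ⟨h1, h2⟩ | ⟨h1, h2⟩
        · exact .inr (.inr ⟨h, .refl⟩)
        · exact .inl h1
        · exact .inr (.inr ⟨h1, .refl⟩)

theorem exists_simple_chain {r : α → α → Prop} {x y : α} (h : Relation.ReflTransGen r x y) :
    ∃ (n : ℕ) (p : ℕ → α), Set.InjOn p (Set.Iic n) ∧ p 0 = x ∧ p n = y ∧
      ∀ i < n, r (p i) (p (i + 1)) := by
  induction h using Relation.ReflTransGen.head_induction_on with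
  | refl => exact ⟨0, fun _ => y, by intro a ha b hb _; simp at ha hb; omega, rfl, rfl, by simp⟩
  | @head a c hac _ ih =>
    obtain ⟨n, p, hp, h0, hn, hr⟩ := ih
    by_cases hx : ∃ i ≤ n, p i = a
    · obtain ⟨i, hi, hia⟩ := hx
      refine ⟨n - i, fun j => p (i + j), ?_, hia, ?_, ?_⟩
      · intro s hs t ht hst
        simp only [Set.mem_Iic] at hs ht
        have := hp (by simp; omega) (by simp; omega) hst
        omega
      · simp only [Nat.add_sub_cancel' hi, hn]
      · intro j hj
        exact hr (i + j) (by omega)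
    · push Not at hx
      refine ⟨n + 1, fun j => Nat.casesOn j a p, ?_, rfl, hn, ?_⟩
      · rintro (_ | s) hs (_ | t) ht hst
        · rfl
        · exact absurd hst.symm (hx t (by simpa using ht))
        · exact absurd hst (hx s (by simpa using hs))
        · have := hp (by simpa using hs) (by simpa using ht) hst
          omega
      · rintro (_ | j) hj
        · simpa [h0] using hac
        · exact hr j (by omega)

/-- Spanning trees are the inclusion-minimal connected edge sets. -/
theorem isSpanningTree_iff {G : Graph α β} {T : Set β} :
    G.IsSpanningTree T ↔ T ⊆ E(G) ∧ (G.restrict T).IsConnected ∧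
      ∀ f ∈ T, ∀ a b, G.IsLink f a b →
        ¬ Relation.ReflTransGen (G.restrict (T \ {f})).Adj a b := by
  constructor
  · rintro ⟨hT, hc, hcyc⟩
    refine ⟨hT, hc, fun f hf a b hab hr => ?_⟩
    obtain ⟨n, p, hp, h0, hn, hadj⟩ := exists_simple_chain hr
    have : Nonempty β := ⟨f⟩
    choose! g hg using hadj
    simp only [restrict_isLink] at hg
    refine hcyc n (fun i => p i) (fun i => if (i : ℕ) = n then f else g i) ⟨?_, ?_, ?_⟩
    · intro i j hij
      exact Fin.ext (hp (by simp; omega) (by simp; omega) hij)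
    · intro i j hij
      have key : ∀ s t : ℕ, s < n → t < n → s < t → g s ≠ g t := by
        intro s t hs ht hlt he
        have h1 := (hg s hs).2
        have h2 := (hg t ht).2
        rw [he] at h1
        rcases h1.eq_and_eq_or_eq_and_eq h2 with ⟨h, -⟩ | ⟨h, -⟩
        · have := hp (by simp; omega) (by simp; omega) h; omega
        · have := hp (by simp; omega) (by simp; omega) h; omega
      have hne : ∀ s < n, g s ≠ f := fun s hs => by have := (hg s hs).1; grind
      apply Fin.ext
      have hi := i.2
      have hj := j.2
      by_cases h1 : (i : ℕ) = n <;> by_cases h2 : (j : ℕ) = n <;> simp only [h1, h2, if_true,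
        if_false] at hij
      · omega
      · exact absurd hij.symm (hne _ (by omega))
      · exact absurd hij (hne _ (by omega))
      · rcases lt_trichotomy (i : ℕ) j with h | h | h
        · exact absurd hij (key _ _ (by omega) (by omega) h)
        · exact h
        · exact absurd hij.symm (key _ _ (by omega) (by omega) h)
    · intro i
      by_cases hi : (i : ℕ) = n
      · have : i = Fin.last n := Fin.ext hi
        subst this
        simp only [Fin.val_last, if_true, Fin.last_add_one, Fin.val_zero, h0, hn, restrict_isLink]
        exact ⟨hf, hab.symm⟩
      · have hlt : (i : ℕ) < n := by omega
        have hs : ((i + 1 : Fin (n + 1)) : ℕ) = i + 1 :=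
          Fin.val_add_one_of_lt (Fin.lt_last_iff_ne_last.2 (by rintro rfl; simp at hi))
        simp only [hi, if_false, hs, restrict_isLink]
        have := hg i hlt
        grind
  · rintro ⟨hT, hc, hb⟩
    refine ⟨hT, hc, fun n v e hcyc => ?_⟩
    have hl := hcyc.isLink (Fin.last n)
    simp only [restrict_isLink, Fin.last_add_one] at hl
    refine hb _ hl.1 _ _ hl.2.symm ?_
    have : ∀ j : ℕ, ∀ hj : j < n + 1,
        Relation.ReflTransGen (G.restrict (T \ {e (Fin.last n)})).Adj (v 0) (v ⟨j, hj⟩) := by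
      intro j
      induction j with
      | zero => intro _; exact .refl
      | succ j ih =>
        intro hj
        refine (ih (by omega)).tail ⟨e ⟨j, by omega⟩, ?_⟩
        have h1 := hcyc.isLink ⟨j, by omega⟩
        have h2 : (⟨j, by omega⟩ + 1 : Fin (n + 1)) = ⟨j + 1, hj⟩ := by
          apply Fin.ext
          rw [Fin.val_add_one_of_lt]
          simp [Fin.lt_def]; omega
        have h3 : e ⟨j, by omega⟩ ≠ e (Fin.last n) := fun h => by
          have := congrArg Fin.val (hcyc.edge_injective h)
          simp at this; omega
        rw [h2] at h1
        simp only [restrict_isLink] at h1 ⊢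
        exact ⟨⟨h1.1, h3⟩, h1.2⟩
    exact this n (by omega)

theorem exists_isSpanningTree {G : Graph α β} (hG : G.IsConnected) (hfin : E(G).Finite) :
    ∃ T, G.IsSpanningTree T := by
  have hF : {T : Set β | T ⊆ E(G) ∧ (G.restrict T).IsConnected}.Finite :=
    hfin.finite_subsets.subset fun T h => h.1
  obtain ⟨T, hT⟩ := hF.exists_minimal ⟨E(G), le_rfl, by simpa using hG⟩
  refine ⟨T, isSpanningTree_iff.2 ⟨hT.1.1, hT.1.2, fun f hf a b hab hr => ?_⟩⟩
  have hins : insert f (T \ {f}) = T := by simp [Set.insert_eq_of_mem hf]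
  have hmem : T \ {f} ∈ {T : Set β | T ⊆ E(G) ∧ (G.restrict T).IsConnected} := by
    refine ⟨Set.sdiff_subset.trans hT.1.1, hT.1.2.1, fun x hx y hy => ?_⟩
    have := hT.1.2.2 x hx y hy
    rw [← hins] at this
    rcases reach_insert hab this with h | ⟨h1, h2⟩ | ⟨h1, h2⟩
    · exact h
    · exact (h1.trans hr).trans h2
    · exact (h1.trans (reach_symm hr)).trans h2
  exact (hT.2 hmem Set.sdiff_subset hf).2 rfl

theorem isSpanningTree_exchange (G : Graph α β) : Matroid.ExchangeProperty G.IsSpanningTree := by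
  intro B₁ B₂ h₁ h₂ x hx
  rw [isSpanningTree_iff] at h₁ h₂
  obtain ⟨hE₁, hc₁, hb₁⟩ := h₁
  obtain ⟨hE₂, hc₂, hb₂⟩ := h₂
  obtain ⟨a, b, hab⟩ := G.exists_isLink_of_mem_edgeSet (hE₁ hx.1)
  have hnab := hb₁ x hx.1 a b hab
  have hins : insert x (B₁ \ {x}) = B₁ := by simp [Set.insert_eq_of_mem hx.1]
  have hside : ∀ z ∈ V(G), Relation.ReflTransGen (G.restrict (B₁ \ {x})).Adj a z ∨
      Relation.ReflTransGen (G.restrict (B₁ \ {x})).Adj b z := by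
    intro z hz
    have := hc₁.2 a hab.left_mem z hz
    rw [← hins] at this
    rcases reach_insert hab this with h | ⟨-, h⟩ | ⟨-, h⟩ <;> tauto
  obtain ⟨y, hyB, u, w, hyl, hu, hw⟩ : ∃ y ∈ B₂, ∃ u w, G.IsLink y u w ∧
      Relation.ReflTransGen (G.restrict (B₁ \ {x})).Adj a u ∧
      ¬ Relation.ReflTransGen (G.restrict (B₁ \ {x})).Adj a w := by
    by_contra! hcon
    refine hnab ?_
    have hr := hc₂.2 a hab.left_mem b hab.right_mem
    clear hnab hside
    generalize b = c at hr
    clear hab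
    induction hr with
    | refl => exact .refl
    | tail _ h ih =>
      obtain ⟨g, hg⟩ := h
      simp only [restrict_isLink] at hg
      exact hcon g hg.1 _ _ hg.2 ih
  have hbw : Relation.ReflTransGen (G.restrict (B₁ \ {x})).Adj b w :=
    (hside w hyl.right_mem).resolve_left hw
  have hyB₁ : y ∉ B₁ := by
    intro hy
    refine hw (hu.tail ⟨y, ?_⟩)
    simp only [restrict_isLink]
    exact ⟨⟨hy, by rintro rfl; exact hx.2 hyB⟩, hyl⟩
  refine ⟨y, ⟨hyB, hyB₁⟩, isSpanningTree_iff.2 ⟨?_, ⟨hc₁.1, ?_⟩, ?_⟩⟩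
  · exact Set.insert_subset (hE₂ hyB) (Set.sdiff_subset.trans hE₁)
  · have hsub : B₁ \ {x} ⊆ insert y (B₁ \ {x}) := Set.subset_insert _ _
    have hall : ∀ z ∈ V(G), Relation.ReflTransGen (G.restrict (insert y (B₁ \ {x}))).Adj a z := by
      intro z hz
      rcases hside z hz with h | h
      · exact reach_mono hsub h
      · refine ((reach_mono hsub hu).tail ⟨y, ?_⟩).trans
          (reach_mono hsub ((reach_symm hbw).trans h))
        simp only [restrict_isLink]
        exact ⟨Set.mem_insert _ _, hyl⟩
    intro s hs t ht
    exact (reach_symm (hall s hs)).trans (hall t ht)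
  · rintro f hf p q hpq hr
    have hnuw : ¬ Relation.ReflTransGen (G.restrict (B₁ \ {x})).Adj u w :=
      fun h => hw (hu.trans h)
    rcases hf with rfl | hf
    · rcases hyl.eq_and_eq_or_eq_and_eq hpq with ⟨rfl, rfl⟩ | ⟨rfl, rfl⟩
      · exact hnuw (reach_mono (by grind) hr)
      · exact hnuw (reach_symm (reach_mono (by grind) hr))
    · have hr' : Relation.ReflTransGen (G.restrict (insert y ((B₁ \ {x}) \ {f}))).Adj p q :=
        reach_mono (by grind) hr
      have hadj : (G.restrict (B₁ \ {x})).Adj p q :=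
        ⟨f, by simp only [restrict_isLink]; exact ⟨hf, hpq⟩⟩
      have hsub : (B₁ \ {x}) \ {f} ⊆ B₁ \ {x} := Set.sdiff_subset
      rcases reach_insert hyl hr' with h | ⟨h1, h2⟩ | ⟨h1, h2⟩
      · exact hb₁ f hf.1 p q hpq (reach_mono (by grind) h)
      · exact hnuw (((reach_symm (reach_mono hsub h1)).tail hadj).trans
          (reach_symm (reach_mono hsub h2)))
      · exact hnuw ((reach_mono hsub h2).trans
          ((reach_symm (Relation.ReflTransGen.single hadj)).trans (reach_mono hsub h1)))

/-- The cycle matroid of a connected graph `G` with finitely many edges: its ground set is `E(G)`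
and its bases are the (edge sets of) spanning trees of `G`. -/
def cycleMatroid (G : Graph α β) (hG : G.IsConnected) (hfin : E(G).Finite) : Matroid β :=
  Matroid.ofIsBaseOfFinite hfin G.IsSpanningTree (exists_isSpanningTree hG hfin)
    G.isSpanningTree_exchange fun _ hB => hB.1

@[simp]
theorem cycleMatroid_ground (G : Graph α β) (hG : G.IsConnected) (hfin : E(G).Finite) :
    (G.cycleMatroid hG hfin).E = E(G) := rfl

@[simp]
theorem cycleMatroid_isBase (G : Graph α β) (hG : G.IsConnected) (hfin : E(G).Finite)
    {B : Set β} : (G.cycleMatroid hG hfin).IsBase B ↔ G.IsSpanningTree B := Iff.rfl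

end Graph

namespace Matroid

/-- A matroid is graphic if it is the cycle matroid of a connected graph (with finitely many
edges; loops and parallel edges are allowed). -/
def IsGraphic {β : Type v} (M : Matroid β) : Prop :=
  ∃ (α : Type u) (G : Graph α β) (hG : G.IsConnected) (hfin : E(G).Finite),
    M = G.cycleMatroid hG hfin

/-- The ordered pair `(B₁, B₂)` has the elementary `k`-exchange property: there are `k`-element
sets `X ⊆ B₁ \ B₂` and `Y ⊆ B₂ \ B₁` and a bijection `φ : X → Y` such that `(B₁ \ Z) ∪ φ(Z)` is a
basis for every `Z ⊆ X`. -/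
def ElementaryExchange {β : Type v} (M : Matroid β) (k : ℕ) (B₁ B₂ : Set β) : Prop :=
  ∃ (X Y : Set β) (φ : β → β), X ⊆ B₁ \ B₂ ∧ Y ⊆ B₂ \ B₁ ∧ X.encard = k ∧ Y.encard = k ∧
    Set.BijOn φ X Y ∧ ∀ Z ⊆ X, M.IsBase ((B₁ \ Z) ∪ φ '' Z)

/-- `M` is elementarily `(a, k)`-weakly base orderable. -/
def ElementarilyWeaklyBaseOrderable {β : Type v} (M : Matroid β) (a k : ℕ) : Prop :=
  ∀ B₁ B₂ : Set β, M.IsBase B₁ → M.IsBase B₂ → (a : ℕ∞) ≤ (B₁ \ B₂).encard →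
    M.ElementaryExchange k B₁ B₂

end Matroid

/-! Fix a root `r`. Removing `x ∈ B₁ \ B₂` from the tree `B₁` cuts off the vertex set `cutSide B₁ r
x`, and any edge across this cut may replace `x`. Several replacements can be made independently
when they are triangular: every nonempty `Z` has an `x` whose cut is avoided by the images of the
rest of `Z`. After the rest is exchanged, `x` is still the only tree edge across its cut, so it can
be exchanged last (`IsTriangularOn.isSpanningTree`).

The cuts form a laminar family of distinct nonempty sets (`cutSide_laminar`, `cutSide_injOn`), so
there are either `k` disjoint ones or a chain of more than `2 * k`. Since `B₂` is connected, it has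
an edge leaving any vertex set that omits `r`. For disjoint cuts, edges leaving their union are
chosen greedily. For a chain, each shell between consecutive cuts has a `B₂`-edge leaving it
outwards or inwards, and the more frequent direction serves at least half of the cuts. -/

namespace Graph

variable {α : Type u} {β : Type v} {G : Graph α β}

/-! ### Cuts and fundamental cuts of a rooted spanning tree -/

/-- The edge `y` has exactly one end in `S`. -/
def Crosses (G : Graph α β) (y : β) (S : Set α) : Prop :=
  ∃ u w, G.IsLink y u w ∧ u ∈ S ∧ w ∉ S

/-- The vertices that are separated from `r` when `x` is removed from `T`. -/
def cutSide (G : Graph α β) (T : Set β) (r : α) (x : β) : Set α :=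
  {z ∈ V(G) | ¬ Relation.ReflTransGen (G.restrict (T \ {x})).Adj r z}

theorem adj_restrict_of_isLink {T : Set β} {y : β} {u w : α} (hy : y ∈ T) (h : G.IsLink y u w) :
    (G.restrict T).Adj u w :=
  ⟨y, by simpa only [restrict_isLink] using ⟨hy, h⟩⟩

theorem reach_stable {T : Set β} {S : Set α} (hS : ∀ y ∈ T, ¬ G.Crosses y S) {a b : α}
    (h : Relation.ReflTransGen (G.restrict T).Adj a b) (ha : a ∈ S) : b ∈ S := by
  induction h with
  | refl => exact ha
  | tail _ h ih =>
    obtain ⟨g, hg⟩ := h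
    simp only [restrict_isLink] at hg
    by_contra hc
    exact hS g hg.1 ⟨_, _, hg.2, ih, hc⟩

theorem exists_crosses {T : Set β} {S : Set α} {a r : α} (hT : (G.restrict T).IsConnected)
    (ha : a ∈ V(G)) (hr : r ∈ V(G)) (haS : a ∈ S) (hrS : r ∉ S) : ∃ y ∈ T, G.Crosses y S := by
  by_contra! hcon
  exact hrS (reach_stable hcon (hT.2 a ha r hr) haS)

/-- Exchanging an edge of a spanning tree for an edge across the corresponding cut. -/
theorem IsSpanningTree.exchange {B : Set β} (hB : G.IsSpanningTree B) {x y : β} (hx : x ∈ B)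
    {S : Set α} (hS : ∀ z ∈ B \ {x}, ¬ G.Crosses z S) (hy : G.Crosses y S) :
    G.IsSpanningTree (insert y (B \ {x})) := by
  rw [isSpanningTree_iff] at hB ⊢
  obtain ⟨hE, hc, hb⟩ := hB
  obtain ⟨u, w, hyl, hu, hw⟩ := hy
  have hnuw : ¬ Relation.ReflTransGen (G.restrict (B \ {x})).Adj u w :=
    fun h => hw (reach_stable hS h hu)
  obtain ⟨a, b, hab⟩ := G.exists_isLink_of_mem_edgeSet (hE hx)
  have hins : insert x (B \ {x}) = B := by simp [Set.insert_eq_of_mem hx]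
  have hsub : B \ {x} ⊆ insert y (B \ {x}) := Set.subset_insert _ _
  have hyadj : (G.restrict (insert y (B \ {x}))).Adj u w :=
    adj_restrict_of_isLink (Set.mem_insert _ _) hyl
  -- `S` separates `u` from `w` in `B \ {x}`, so their connection in `B` uses `x`; going round
  -- through `y` instead joins the ends of `x`.
  have hab' : Relation.ReflTransGen (G.restrict (insert y (B \ {x}))).Adj a b := by
    have := hc.2 u hyl.left_mem w hyl.right_mem
    rw [← hins] at this
    rcases reach_insert hab this with h | ⟨h1, h2⟩ | ⟨h1, h2⟩
    · exact absurd h hnuw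
    · exact ((reach_symm (reach_mono hsub h1)).tail hyadj).trans (reach_symm (reach_mono hsub h2))
    · exact reach_symm
        (((reach_symm (reach_mono hsub h1)).tail hyadj).trans (reach_symm (reach_mono hsub h2)))
  refine ⟨Set.insert_subset hyl.edge_mem (Set.sdiff_subset.trans hE), ⟨hc.1, ?_⟩, ?_⟩
  · intro s hs t ht
    have := hc.2 s hs t ht
    rw [← hins] at this
    rcases reach_insert hab this with h | ⟨h1, h2⟩ | ⟨h1, h2⟩
    · exact reach_mono hsub h
    · exact ((reach_mono hsub h1).trans hab').trans (reach_mono hsub h2)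
    · exact ((reach_mono hsub h1).trans (reach_symm hab')).trans (reach_mono hsub h2)
  · rintro f hf p q hpq hr
    rcases hf with rfl | hf
    · rcases hyl.eq_and_eq_or_eq_and_eq hpq with ⟨rfl, rfl⟩ | ⟨rfl, rfl⟩
      · exact hnuw (reach_mono (by grind) hr)
      · exact hnuw (reach_symm (reach_mono (by grind) hr))
    · have hr' : Relation.ReflTransGen (G.restrict (insert y ((B \ {x}) \ {f}))).Adj p q :=
        reach_mono (by grind) hr
      have hadj : (G.restrict (B \ {x})).Adj p q := adj_restrict_of_isLink hf hpq
      have hsub : (B \ {x}) \ {f} ⊆ B \ {x} := Set.sdiff_subset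
      rcases reach_insert hyl hr' with h | ⟨h1, h2⟩ | ⟨h1, h2⟩
      · exact hb f hf.1 p q hpq (reach_mono (by grind) h)
      · exact hnuw (((reach_symm (reach_mono hsub h1)).tail hadj).trans
          (reach_symm (reach_mono hsub h2)))
      · exact hnuw ((reach_mono hsub h2).trans
          ((reach_symm (Relation.ReflTransGen.single hadj)).trans (reach_mono hsub h1)))

theorem root_notMem_cutSide {T : Set β} {r : α} {x : β} : r ∉ G.cutSide T r x :=
  fun h => h.2 .refl

theorem eq_of_crosses_cutSide {T : Set β} {r : α} {x y : β} (hy : y ∈ T)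
    (h : G.Crosses y (G.cutSide T r x)) : y = x := by
  obtain ⟨u, w, hl, hu, hw⟩ := h
  by_contra hne
  have hw' : Relation.ReflTransGen (G.restrict (T \ {x})).Adj r w := by
    by_contra hc
    exact hw ⟨hl.right_mem, hc⟩
  exact hu.2 (hw'.tail (adj_restrict_of_isLink (by exact ⟨hy, hne⟩) hl.symm))

theorem IsSpanningTree.crosses_cutSide {T : Set β} (hT : G.IsSpanningTree T) {r : α}
    (hr : r ∈ V(G)) {x : β} (hx : x ∈ T) : G.Crosses x (G.cutSide T r x) := by
  rw [isSpanningTree_iff] at hT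
  obtain ⟨hE, hc, hb⟩ := hT
  obtain ⟨a, b, hab⟩ := G.exists_isLink_of_mem_edgeSet (hE hx)
  have hnab := hb x hx a b hab
  have hins : insert x (T \ {x}) = T := by simp [Set.insert_eq_of_mem hx]
  have hra := hc.2 r hr a hab.left_mem
  rw [← hins] at hra
  have key : Relation.ReflTransGen (G.restrict (T \ {x})).Adj r a ∨
      Relation.ReflTransGen (G.restrict (T \ {x})).Adj r b := by
    rcases reach_insert hab hra with h | ⟨h, -⟩ | ⟨h, -⟩ <;> tauto
  rcases key with h | h
  · exact ⟨b, a, hab.symm, ⟨hab.right_mem, fun h' => hnab ((reach_symm h).trans h')⟩,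
      fun h' => h'.2 h⟩
  · exact ⟨a, b, hab, ⟨hab.left_mem, fun h' => hnab ((reach_symm h').trans h)⟩,
      fun h' => h'.2 h⟩

theorem IsSpanningTree.cutSide_injOn {T : Set β} (hT : G.IsSpanningTree T) {r : α}
    (hr : r ∈ V(G)) : Set.InjOn (G.cutSide T r) T := by
  intro x hx y hy hxy
  exact eq_of_crosses_cutSide hx (hxy ▸ hT.crosses_cutSide hr hx)

/-- In the tree rooted at `r`, the cut side of an edge is the set of vertices below it. -/
theorem IsSpanningTree.cutSide_laminar {T : Set β} (hT : G.IsSpanningTree T) {r : α}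
    (hr : r ∈ V(G)) {x y : β} (hx : x ∈ T) (hy : y ∈ T) :
    G.cutSide T r x ⊆ G.cutSide T r y ∨ G.cutSide T r y ⊆ G.cutSide T r x ∨
      Disjoint (G.cutSide T r x) (G.cutSide T r y) := by
  by_cases hxy : x = y
  · subst hxy
    exact .inl le_rfl
  -- A vertex cut off by `y` but not by `x` would be reached from `r` through `y` without using `x`,
  -- and then so would the end `b`.
  have nest : ∀ {x y : β} {b : α}, x ≠ y → y ∈ T → b ∈ G.cutSide T r x →
      (∃ a, G.IsLink y b a) → G.cutSide T r y ⊆ G.cutSide T r x := by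
    rintro x y b hne hy hb ⟨a, hl⟩ z hz
    refine ⟨hz.1, fun hrz => ?_⟩
    have hmem : y ∈ T \ {x} := ⟨hy, hne.symm⟩
    have hrz' : Relation.ReflTransGen
        (G.restrict (insert y ((T \ {x}) \ {y}))).Adj r z := by
      rwa [Set.insert_sdiff_singleton, Set.insert_eq_of_mem hmem]
    have hsx : (T \ {x}) \ {y} ⊆ T \ {x} := Set.sdiff_subset
    rcases reach_insert hl hrz' with h | ⟨h, -⟩ | ⟨h, -⟩
    · exact hz.2 (reach_mono (by grind) h)
    · exact hb.2 (reach_mono hsx h)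
    · exact hb.2 ((reach_mono hsx h).tail (adj_restrict_of_isLink hmem hl.symm))
  obtain ⟨b, a, hab, hb, ha⟩ := hT.crosses_cutSide hr hx
  obtain ⟨b', a', hab', hb', ha'⟩ := hT.crosses_cutSide hr hy
  by_cases h1 : b' ∈ G.cutSide T r x
  · exact .inr (.inl (nest hxy hy h1 ⟨_, hab'⟩))
  by_cases h2 : a' ∈ G.cutSide T r x
  · exact .inr (.inl (nest hxy hy h2 ⟨_, hab'.symm⟩))
  by_cases h3 : b ∈ G.cutSide T r y
  · exact .inl (nest (Ne.symm hxy) hx h3 ⟨_, hab⟩)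
  refine .inr (.inr (Set.disjoint_left.2 fun z hz hz' => ?_))
  -- A tree edge leaving the intersection crosses one of the two cuts, so it is `x` or `y`, with an
  -- end inside the other side. That has been excluded.
  obtain ⟨e, he, u, w, hl, hu, hw⟩ := exists_crosses
    (S := G.cutSide T r x ∩ G.cutSide T r y) ⟨hT.2.1.1, hT.2.1.2⟩ hz.1 hr ⟨hz, hz'⟩
    (fun h => root_notMem_cutSide h.1)
  by_cases hwx : w ∈ G.cutSide T r x
  · obtain rfl := eq_of_crosses_cutSide he ⟨u, w, hl, hu.2, fun h => hw ⟨hwx, h⟩⟩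
    rcases hl.eq_and_eq_or_eq_and_eq hab' with ⟨rfl, rfl⟩ | ⟨rfl, rfl⟩
    · exact h1 hu.1
    · exact h2 hu.1
  · obtain rfl := eq_of_crosses_cutSide he ⟨u, w, hl, hu.1, hwx⟩
    rcases hl.eq_and_eq_or_eq_and_eq hab with ⟨rfl, rfl⟩ | ⟨rfl, rfl⟩
    · exact h3 hu.2
    · exact ha hu.1

/-! ### Triangular exchanges -/

/-- The exchange `φ` on `K` is triangular with respect to the cuts `D`: every nonempty part of `K`
has an element whose cut is avoided by the images of all the others. -/
def IsTriangularOn (G : Graph α β) (D : β → Set α) (K : Finset β) (φ : β → β) : Prop :=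
  ∀ Z ⊆ K, Z.Nonempty → ∃ x ∈ Z, ∀ z ∈ Z, z ≠ x → ¬ G.Crosses (φ z) (D x)

theorem isTriangularOn_of_ssubset {D : β → Set α} {K : Finset β} {φ : β → β}
    (h : ∀ x ∈ K, ∀ z ∈ K, z ≠ x → G.Crosses (φ z) (D x) → D z ⊂ D x) :
    G.IsTriangularOn D K φ := by
  intro Z hZK hZ
  obtain ⟨x, hx⟩ := Z.exists_minimalFor D hZ
  exact ⟨x, hx.1, fun z hz hzx hc =>
    (h x (hZK hx.1) z (hZK hz) hzx hc).2 (hx.2 hz (h x (hZK hx.1) z (hZK hz) hzx hc).1)⟩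

theorem isTriangularOn_of_ssuperset {D : β → Set α} {K : Finset β} {φ : β → β}
    (h : ∀ x ∈ K, ∀ z ∈ K, z ≠ x → G.Crosses (φ z) (D x) → D x ⊂ D z) :
    G.IsTriangularOn D K φ := by
  intro Z hZK hZ
  obtain ⟨x, hx⟩ := Z.exists_maximalFor D hZ
  exact ⟨x, hx.1, fun z hz hzx hc =>
    (h x (hZK hx.1) z (hZK hz) hzx hc).2 (hx.2 hz (h x (hZK hx.1) z (hZK hz) hzx hc).1)⟩

theorem IsTriangularOn.mono {D : β → Set α} {K L : Finset β} {φ : β → β}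
    (h : G.IsTriangularOn D L φ) (hKL : K ⊆ L) : G.IsTriangularOn D K φ :=
  fun Z hZ hne => h Z (hZ.trans hKL) hne

/-- Two elements with a common image would each have their cut crossed by the image of the other, so
the pair would violate triangularity. -/
theorem IsTriangularOn.injOn {D : β → Set α} {K : Finset β} {φ : β → β}
    (h : G.IsTriangularOn D K φ) (hc : ∀ x ∈ K, G.Crosses (φ x) (D x)) :
    Set.InjOn φ (K : Set β) := by
  classical
  intro x hx y hy hxy
  by_contra hne
  obtain ⟨z, hz, hz'⟩ := h {x, y} (by
    intro w hw
    rcases Finset.mem_insert.1 hw with rfl | hw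
    · exact hx
    · exact Finset.mem_singleton.1 hw ▸ hy) ⟨x, by simp⟩
  rcases Finset.mem_insert.1 hz with rfl | hz
  · exact hz' y (by simp) (Ne.symm hne) (hxy ▸ hc _ hx)
  · obtain rfl := Finset.mem_singleton.1 hz
    exact hz' x (by simp) hne (hxy ▸ hc _ hy)

theorem IsTriangularOn.isSpanningTree {T : Set β} (hT : G.IsSpanningTree T) {r : α}
    {K : Finset β} {φ : β → β} (h : G.IsTriangularOn (G.cutSide T r) K φ) (hKT : (K : Set β) ⊆ T)
    (hc : ∀ x ∈ K, G.Crosses (φ x) (G.cutSide T r x)) (hφ : ∀ x ∈ K, φ x ∉ T) :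
    G.IsSpanningTree ((T \ K) ∪ φ '' K) := by
  classical
  induction K using Finset.strongInduction with
  | H K ih =>
    rcases K.eq_empty_or_nonempty with rfl | hne
    · simpa using hT
    obtain ⟨x, hx, hx'⟩ := h K subset_rfl hne
    have hsub : K.erase x ⊆ K := K.erase_subset x
    have hB := ih (K.erase x) (Finset.erase_ssubset hx) (h.mono hsub)
      (fun z hz => hKT (hsub hz)) (fun z hz => hc z (hsub hz)) (fun z hz => hφ z (hsub hz))
    have hnx : ∀ z ∈ K, φ z ≠ x := fun z hz e => hφ z hz (e ▸ hKT hx)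
    have hnew := hB.exchange (x := x) (y := φ x) (S := G.cutSide T r x)
      (.inl ⟨hKT hx, by simp⟩) (by
        rintro z ⟨⟨hzT, -⟩ | ⟨w, hw, rfl⟩, hzx⟩ hcz
        · exact hzx (eq_of_crosses_cutSide hzT hcz)
        · have hw' := Finset.mem_erase.1 (Finset.mem_coe.1 hw)
          exact hx' w hw'.2 hw'.1 hcz) (hc x hx)
    convert hnew using 1
    ext e
    simp only [Set.mem_union, Set.mem_sdiff, Finset.mem_coe, Set.mem_image, Set.mem_insert_iff,
      Finset.mem_erase, Set.mem_singleton_iff]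
    constructor
    · rintro (⟨h1, h2⟩ | ⟨z, hz, rfl⟩)
      · exact .inr ⟨.inl ⟨h1, fun h => h2 h.2⟩, fun h => h2 (h ▸ hx)⟩
      · by_cases hzx : z = x
        · exact .inl (hzx ▸ rfl)
        · exact .inr ⟨.inr ⟨z, ⟨hzx, hz⟩, rfl⟩, hnx z hz⟩
    · rintro (rfl | ⟨⟨h1, h2⟩ | ⟨z, hz, rfl⟩, h3⟩)
      · exact .inr ⟨x, hx, rfl⟩
      · exact .inl ⟨h1, fun h => h2 ⟨h3, h⟩⟩
      · exact .inr ⟨z, hz.2, rfl⟩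

/-! ### Triangular choices for disjoint and for nested cuts -/

/-- Pairwise disjoint cuts admit a triangular choice of crossing edges. -/
theorem exists_isTriangularOn_of_disjoint {T : Set β} (hT : (G.restrict T).IsConnected)
    {D : β → Set α} {r : α} (hr : r ∈ V(G)) (A : Finset β) (hrD : ∀ x ∈ A, r ∉ D x)
    (hne : ∀ x ∈ A, ∃ a ∈ V(G), a ∈ D x)
    (hdisj : ∀ x ∈ A, ∀ y ∈ A, x ≠ y → Disjoint (D x) (D y)) :
    ∃ φ : β → β, (∀ x ∈ A, φ x ∈ T ∧ G.Crosses (φ x) (D x)) ∧ G.IsTriangularOn D A φ := by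
  classical
  induction A using Finset.strongInduction with
  | H A ih =>
    rcases A.eq_empty_or_nonempty with rfl | ⟨x₀, hx₀⟩
    · exact ⟨id, by simp, fun Z hZ hZ' => by simp_all⟩
    obtain ⟨a, ha, haD⟩ := hne x₀ hx₀
    -- An edge leaving the whole union has one end in a single `D x` and the other in no member, so
    -- it crosses no other cut. It becomes the image of `x`, and the induction continues without
    -- `x`.
    obtain ⟨y, hy, u, w, hl, hu, hw⟩ := exists_crosses (S := ⋃ x ∈ A, D x) hT ha hr
      (Set.mem_biUnion (Finset.mem_coe.2 hx₀) haD) (by simpa using hrD)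
    simp only [Set.mem_iUnion, exists_prop, not_exists, not_and] at hu hw
    obtain ⟨x, hx, hux⟩ := hu
    have hsub : A.erase x ⊆ A := A.erase_subset x
    obtain ⟨φ, hφ, htri⟩ := ih (A.erase x) (Finset.erase_ssubset hx)
      (fun z hz => hrD z (hsub hz)) (fun z hz => hne z (hsub hz))
      (fun z hz z' hz' => hdisj z (hsub hz) z' (hsub hz'))
    refine ⟨Function.update φ x y, fun z hz => ?_, fun Z hZ hZne => ?_⟩
    · by_cases hzx : z = x
      · subst hzx
        simpa using ⟨hy, u, w, hl, hux, hw z hx⟩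
      · simpa [Function.update_of_ne hzx] using hφ z (Finset.mem_erase.2 ⟨hzx, hz⟩)
    · rcases (Z.erase x).eq_empty_or_nonempty with he | hne'
      · obtain ⟨z, hz⟩ := hZne
        refine ⟨z, hz, fun z' hz' hzz' => ?_⟩
        have hone : ∀ t ∈ Z, t = x := fun t ht => by
          by_contra htx
          have := Finset.mem_erase.2 ⟨htx, ht⟩
          simp [he] at this
        exact absurd ((hone z' hz').trans (hone z hz).symm) hzz'
      · obtain ⟨z, hz, hz'⟩ := htri (Z.erase x) (Finset.erase_subset_erase x hZ) hne'
        have hzx := (Finset.mem_erase.1 hz).1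
        have hzZ := (Finset.mem_erase.1 hz).2
        refine ⟨z, hzZ, fun t ht htz hcr => ?_⟩
        by_cases htx : t = x
        · subst htx
          simp only [Function.update_self] at hcr
          obtain ⟨p, q, hpq, hp, -⟩ := hcr
          rcases hl.eq_and_eq_or_eq_and_eq hpq with ⟨rfl, rfl⟩ | ⟨rfl, rfl⟩
          · exact Set.disjoint_left.1 (hdisj z (hZ hzZ) t hx hzx) hp hux
          · exact hw z (hZ hzZ) hp
        · rw [Function.update_of_ne htx] at hcr
          exact hz' t (Finset.mem_erase.2 ⟨htx, ht⟩) htz hcr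

/-- Among `2 * k - 1` strictly nested cuts, some `k` admit a triangular choice of crossing
edges. -/
theorem exists_isTriangularOn_of_chain {T : Set β} (hT : (G.restrict T).IsConnected)
    {D : β → Set α} {r : α} (hr : r ∈ V(G)) (C : Finset β) {k : ℕ} (hk : 2 * k ≤ C.card + 1)
    (hDV : ∀ x ∈ C, D x ⊆ V(G)) (hrD : ∀ x ∈ C, r ∉ D x) (hne : ∀ x ∈ C, (D x).Nonempty)
    (hinj : Set.InjOn D C) (hchain : ∀ x ∈ C, ∀ y ∈ C, D x ⊆ D y ∨ D y ⊆ D x) :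
    ∃ K ⊆ C, k ≤ K.card ∧ ∃ φ : β → β,
      (∀ x ∈ K, φ x ∈ T ∧ G.Crosses (φ x) (D x)) ∧ G.IsTriangularOn D K φ := by
  classical
  -- `Lo x y`: `y` crosses `D x` but no smaller cut of the chain. `Up x y`: `y` crosses `D x` but no
  -- larger one. Either kind of choice alone is triangular.
  set Lo : β → β → Prop := fun x y => y ∈ T ∧ G.Crosses y (D x) ∧
    ∀ z ∈ C, D z ⊂ D x → ¬ G.Crosses y (D z) with hLo
  set Up : β → β → Prop := fun x y => y ∈ T ∧ G.Crosses y (D x) ∧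
    ∀ z ∈ C, D x ⊂ D z → ¬ G.Crosses y (D z) with hUp
  have hlt : ∀ x ∈ C, ∀ z ∈ C, z ≠ x → ¬ D x ⊂ D z → D z ⊂ D x := fun x hx z hz hzx h => by
    have hDne : D z ≠ D x := fun e => hzx (hinj hz hx e)
    rcases hchain x hx z hz with h' | h'
    · exact absurd (h'.ssubset_of_ne hDne.symm) h
    · exact h'.ssubset_of_ne hDne
  -- If `x` has no `Lo` edge, then its predecessor `s` in the chain exists and has an `Up` edge.
  have step : ∀ x ∈ C, (¬ ∃ y, Lo x y) → ∃ s ∈ C, D s ⊂ D x ∧ (∃ y, Up s y) ∧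
      ∀ z ∈ C, D z ⊂ D x → D z ⊆ D s := by
    intro x hx hnot
    rcases (C.filter fun z => D z ⊂ D x).eq_empty_or_nonempty with he | hne'
    · exfalso
      obtain ⟨a, ha⟩ := hne x hx
      obtain ⟨y, hy, hcr⟩ := exists_crosses hT (hDV x hx ha) hr ha (hrD x hx)
      refine hnot ⟨y, hy, hcr, fun z hz hzx => ?_⟩
      have : z ∈ C.filter fun z => D z ⊂ D x := Finset.mem_filter.2 ⟨hz, hzx⟩
      simp [he] at this
    · obtain ⟨s, hs, hsmax⟩ := (C.filter fun z => D z ⊂ D x).exists_maximalFor D hne'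
      obtain ⟨hsC, hsx⟩ := Finset.mem_filter.1 hs
      have hsucc : ∀ z ∈ C, D z ⊂ D x → D z ⊆ D s := fun z hz hzx => by
        rcases hchain z hz s hsC with h | h
        · exact h
        · exact hsmax (Finset.mem_filter.2 ⟨hz, hzx⟩) h
      obtain ⟨a, ha, has⟩ := Set.exists_of_ssubset hsx
      -- The edge leaves the shell `D x \ D s`. If it ended outside `D x`, it would be a `Lo` edge
      -- for `x`; hence it ends in `D s` and stays within `D x`.
      obtain ⟨y, hy, u, w, hl, hu, hw⟩ := exists_crosses (S := D x \ D s) hT (hDV x hx ha) hr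
        ⟨ha, has⟩ (fun h => hrD x hx h.1)
      have hws : w ∈ D s := by
        by_contra hws
        have hwx : w ∉ D x := fun h => hw ⟨h, hws⟩
        refine hnot ⟨y, hy, ⟨u, w, hl, hu.1, hwx⟩, fun z hz hzx => ?_⟩
        rintro ⟨p, q, hpq, hp, -⟩
        have hp' := hsucc z hz hzx hp
        rcases hl.eq_and_eq_or_eq_and_eq hpq with ⟨rfl, rfl⟩ | ⟨rfl, rfl⟩
        · exact hu.2 hp'
        · exact hws hp'
      refine ⟨s, hsC, hsx, ⟨y, hy, ⟨w, u, hl.symm, hws, hu.2⟩, fun z hz hsz => ?_⟩, hsucc⟩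
      have hxz : D x ⊆ D z := by
        by_contra hxz
        have hzx : D z ⊂ D x := ⟨(hchain x hx z hz).resolve_left hxz, hxz⟩
        exact hsz.2 (hsucc z hz hzx)
      rintro ⟨p, q, hpq, -, hq⟩
      rcases hl.eq_and_eq_or_eq_and_eq hpq with ⟨rfl, rfl⟩ | ⟨rfl, rfl⟩
      · exact hq (hxz (hsx.1 hws))
      · exact hq (hxz hu.1)
  choose! s hsC hsx hsUp hsucc using step
  have hcard : C.card ≤ (C.filter fun x => ∃ y, Lo x y).card +
      (C.filter fun x => ∃ y, Up x y).card := by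
    -- Distinct members of a chain have distinct predecessors, so `s` injects the elements without a
    -- `Lo` edge into those with an `Up` edge.
    rw [← Finset.card_filter_add_card_filter_not (s := C) fun x => ∃ y, Lo x y]
    refine Nat.add_le_add_left (Finset.card_le_card_of_injOn s ?_ ?_) _
    · intro x hx
      obtain ⟨hx, hnx⟩ := Finset.mem_filter.1 hx
      exact Finset.mem_filter.2 ⟨hsC x hx hnx, hsUp x hx hnx⟩
    · intro x hx z hz hxz
      obtain ⟨hx, hnx⟩ := Finset.mem_filter.1 hx
      obtain ⟨hz, hnz⟩ := Finset.mem_filter.1 hz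
      by_contra hne
      by_cases h : D x ⊂ D z
      · exact (hsx x hx hnx).2 (hxz ▸ hsucc z hz hnz x hx h)
      · exact (hsx z hz hnz).2 (hxz ▸ hsucc x hx hnx z hz (hlt x hx z hz (Ne.symm hne) h))
  rcases (by omega : k ≤ (C.filter fun x => ∃ y, Lo x y).card ∨
      k ≤ (C.filter fun x => ∃ y, Up x y).card) with h | h
  · refine ⟨_, Finset.filter_subset _ _, h, ?_⟩
    have hy : ∀ x ∈ C.filter fun x => ∃ y, Lo x y, ∃ y, Lo x y := fun x hx =>
      (Finset.mem_filter.1 hx).2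
    choose! φ hφ using hy
    refine ⟨φ, fun x hx => ⟨(hφ x hx).1, (hφ x hx).2.1⟩,
      isTriangularOn_of_ssubset fun x hx z hz hzx hcr => ?_⟩
    exact hlt x (Finset.mem_filter.1 hx).1 z (Finset.mem_filter.1 hz).1 hzx
      fun hlt' => (hφ z hz).2.2 x (Finset.mem_filter.1 hx).1 hlt' hcr
  · refine ⟨_, Finset.filter_subset _ _, h, ?_⟩
    have hy : ∀ x ∈ C.filter fun x => ∃ y, Up x y, ∃ y, Up x y := fun x hx =>
      (Finset.mem_filter.1 hx).2
    choose! φ hφ using hy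
    refine ⟨φ, fun x hx => ⟨(hφ x hx).1, (hφ x hx).2.1⟩,
      isTriangularOn_of_ssuperset fun x hx z hz hzx hcr => ?_⟩
    exact hlt z (Finset.mem_filter.1 hz).1 x (Finset.mem_filter.1 hx).1 (Ne.symm hzx)
      fun hlt' => (hφ z hz).2.2 x (Finset.mem_filter.1 hx).1 hlt' hcr

end Graph

/-! ### Disjoint sets and chains in laminar families -/

/-- A large laminar family of distinct nonempty sets contains many disjoint sets or a long
chain. -/
theorem Finset.exists_disjoint_or_chain_of_laminar {ι : Type*} {α : Type*} (P : Finset ι)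
    (D : ι → Set α) (hne : ∀ x ∈ P, (D x).Nonempty) (hinj : Set.InjOn D P)
    (hlam : ∀ x ∈ P, ∀ y ∈ P, D x ⊆ D y ∨ D y ⊆ D x ∨ Disjoint (D x) (D y)) {k m : ℕ}
    (hcard : k * m < P.card) :
    (∃ A ⊆ P, k < A.card ∧ ∀ x ∈ A, ∀ y ∈ A, x ≠ y → Disjoint (D x) (D y)) ∨
    (∃ C ⊆ P, m < C.card ∧ ∀ x ∈ C, ∀ y ∈ C, D x ⊆ D y ∨ D y ⊆ D x) := by
  classical
  -- The minimal members are pairwise disjoint by laminarity.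
  set A := P.filter fun x => ∀ y ∈ P, D y ⊆ D x → D x ⊆ D y with hA
  by_cases hAk : k < A.card
  · refine .inl ⟨A, Finset.filter_subset _ _, hAk, fun x hx y hy hxy => ?_⟩
    obtain ⟨hx, hx'⟩ := Finset.mem_filter.1 hx
    obtain ⟨hy, hy'⟩ := Finset.mem_filter.1 hy
    rcases hlam x hx y hy with h | h | h
    · exact absurd (hinj hx hy (h.antisymm (hy' x hx h))) hxy
    · exact absurd (hinj hx hy ((hx' y hy h).antisymm h)) hxy
    · exact h
  · have hbelow : ∀ x ∈ P, ∃ a ∈ A, D a ⊆ D x := fun x hx => by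
      obtain ⟨a, ha, hmin⟩ := (P.filter fun z => D z ⊆ D x).exists_minimalFor D
        ⟨x, Finset.mem_filter.2 ⟨hx, subset_rfl⟩⟩
      obtain ⟨haP, hax⟩ := Finset.mem_filter.1 ha
      exact ⟨a, Finset.mem_filter.2 ⟨haP, fun y hy hya =>
        hmin (Finset.mem_filter.2 ⟨hy, hya.trans hax⟩) hya⟩, hax⟩
    choose! f hfA hfD using hbelow
    -- With at most `k` minimal members, more than `m` sets lie above the same one; they share its
    -- points, so laminarity makes them a chain.
    obtain ⟨a, ha, hlt⟩ := Finset.exists_lt_card_fiber_of_mul_lt_card_of_maps_to hfA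
      (lt_of_le_of_lt (Nat.mul_le_mul_right m (not_lt.1 hAk)) hcard)
    refine .inr ⟨_, Finset.filter_subset _ _, hlt, fun x hx y hy => ?_⟩
    obtain ⟨hx, hxa⟩ := Finset.mem_filter.1 hx
    obtain ⟨hy, hya⟩ := Finset.mem_filter.1 hy
    obtain ⟨z, hz⟩ := hne a (Finset.mem_filter.1 ha).1
    rcases hlam x hx y hy with h | h | h
    · exact .inl h
    · exact .inr h
    · exact absurd (hfD y hy (hya ▸ hz)) (Set.disjoint_left.1 h (hfD x hx (hxa ▸ hz)))

/-! ### The exchange property for graphic matroids -/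

theorem mainTheorem7 {β : Type v} (M : Matroid β) (hM : Matroid.IsGraphic.{u, v} M)
    (k : ℕ) (hk : 1 ≤ k) :
    M.ElementarilyWeaklyBaseOrderable (3 * k ^ 3) k := by
  classical
  obtain ⟨α, G, hG, hfin, rfl⟩ := hM
  intro B₁ B₂ h₁ h₂ hcard
  simp only [Matroid.ElementaryExchange, Graph.cycleMatroid_isBase] at h₁ h₂ ⊢
  obtain ⟨r, hr⟩ := hG.1
  have hPfin : (B₁ \ B₂).Finite := hfin.subset (Set.sdiff_subset.trans h₁.1)
  obtain ⟨P, hP⟩ := hPfin.exists_finset_coe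
  rw [← hP, Set.encard_coe_eq_coe_finsetCard, Nat.cast_le] at hcard
  have hP₁ : ∀ x ∈ P, x ∈ B₁ := fun x hx => (hP ▸ Finset.mem_coe.2 hx : x ∈ B₁ \ B₂).1
  have hP₂ : ∀ x ∈ P, x ∉ B₂ := fun x hx => (hP ▸ Finset.mem_coe.2 hx : x ∈ B₁ \ B₂).2
  have hne : ∀ x ∈ P, (G.cutSide B₁ r x).Nonempty := fun x hx => by
    obtain ⟨u, -, -, hu, -⟩ := h₁.crosses_cutSide hr (hP₁ x hx)
    exact ⟨u, hu⟩
  have hinj : Set.InjOn (G.cutSide B₁ r) P := (h₁.cutSide_injOn hr).mono hP₁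
  obtain ⟨K, hKP, hKk, φ, hφ, htri⟩ : ∃ K ⊆ P, k ≤ K.card ∧ ∃ φ : β → β,
      (∀ x ∈ K, φ x ∈ B₂ ∧ G.Crosses (φ x) (G.cutSide B₁ r x)) ∧
      G.IsTriangularOn (G.cutSide B₁ r) K φ := by
    -- This quadratic bound is all that is needed from `3 * k ^ 3`: it yields at least `k` disjoint
    -- cuts or a chain of more than `2 * k`.
    have hbound : (k - 1) * (2 * k) < P.card := by
      refine lt_of_lt_of_le ?_ hcard
      obtain ⟨j, rfl⟩ := Nat.exists_eq_add_of_le hk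
      simp only [Nat.add_sub_cancel_left]
      nlinarith [Nat.zero_le (j ^ 3), Nat.zero_le (j ^ 2)]
    rcases P.exists_disjoint_or_chain_of_laminar (G.cutSide B₁ r) hne hinj
      (fun x hx y hy => h₁.cutSide_laminar hr (hP₁ x hx) (hP₁ y hy)) hbound with
      ⟨A, hAP, hA, hdisj⟩ | ⟨C, hCP, hC, hchain⟩
    · exact ⟨A, hAP, by omega, Graph.exists_isTriangularOn_of_disjoint h₂.2.1 hr A
        (fun x _ => Graph.root_notMem_cutSide)
        (fun x hx => (hne x (hAP hx)).imp fun z hz => ⟨hz.1, hz⟩) hdisj⟩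
    · obtain ⟨K, hKC, h⟩ := Graph.exists_isTriangularOn_of_chain h₂.2.1 hr C (k := k) (by omega)
        (fun x _ z hz => hz.1) (fun x _ => Graph.root_notMem_cutSide)
        (fun x hx => hne x (hCP hx)) (hinj.mono (Finset.coe_subset.2 hCP)) hchain
      exact ⟨K, hKC.trans hCP, h⟩
  obtain ⟨X, hXK, hXk⟩ := Finset.exists_subset_card_eq hKk
  -- The only edge of `B₁` across the cut of `x` is `x` itself, which is not in `B₂`.
  have hφ₁ : ∀ x ∈ X, φ x ∉ B₁ := fun x hx h => by
    have hxP := hKP (hXK hx)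
    have := Graph.eq_of_crosses_cutSide h (hφ x (hXK hx)).2
    exact hP₂ x hxP (this ▸ (hφ x (hXK hx)).1)
  have hφinj : Set.InjOn φ (X : Set β) :=
    (htri.mono hXK).injOn fun x hx => (hφ x (hXK hx)).2
  refine ⟨X, φ '' X, φ, ?_, ?_, ?_, ?_, hφinj.bijOn_image, fun Z hZ => ?_⟩
  · rw [← hP]
    exact Finset.coe_subset.2 (hXK.trans hKP)
  · rintro _ ⟨x, hx, rfl⟩
    exact ⟨(hφ x (hXK hx)).1, hφ₁ x hx⟩
  · rw [Set.encard_coe_eq_coe_finsetCard, hXk]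
  · rw [hφinj.encard_image, Set.encard_coe_eq_coe_finsetCard, hXk]
  · obtain ⟨Z, rfl⟩ := (X.finite_toSet.subset hZ).exists_finset_coe
    have hZX : Z ⊆ X := Finset.coe_subset.1 hZ
    exact ((htri.mono hXK).mono hZX).isSpanningTree h₁
      (fun x hx => hP₁ x (hKP (hXK (hZX hx)))) (fun x hx => (hφ x (hXK (hZX hx))).2)
      (fun x hx => hφ₁ x (hZX hx))
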